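/- Call a sextuple $(a_1,a_2,b_1,b_2,c_1,c_2)$ \emph{admissible} if $a_1\ne a_2$, $b_1\ne b_2$, $c_1\ne c_2$, the sets $\{a_1,a_2\},\{b_1,b_2\},\{c_1,c_2\}$ are pairwise different, and $\{a_1,a_2\}\cap\{b_1,b_2\}\cap\{c_1,c_2\}=\emptyset$. For a sextuple $T$ of points of $\mathbb R^2$ with $a_1\neq a_2$, $b_1\neq b_2$, $c_1\neq c_2$, let $A$ be the line through $a_1$ and $a_2$, directed from $a_1$ to $a_2$, and define $B$ and $C$ likewise from $b_1,b_2$ and $c_1,c_2$. Call $T$ \emph{degenerate} if one of $A,B,C$ is vertical, or $A$ is parallel (or equal) to $B$ or to $C$, or $A,B,C$ have a common point. The \emph{type} of $T$ is $\sigma(T)=0$ if $T$ is degenerate; otherwise $\sigma(T)=-1$ if $A\cap B$ comes before $A\cap C$ on $A$, and $\sigma(T)=+1$ if it comes after. The \emph{super-order type} of a sequence $(x_1,\dots,x_n)$ of distinct points of $\mathbb R^2$ is the family of the types $\sigma(x_{i_1},x_{i_2},x_{j_1},x_{j_2},x_{k_1},x_{k_2})$, indexed by the admissible sextuples $(i_1,i_2,j_1,j_2,k_1,k_2)$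 of elements of $\{1,\dots,n\}$. An \emph{$h$-obstacle representation} of a graph $G=(V,E)$ is a pair $(\varphi,S)$, where $\varphi:V\to\mathbb R^2$ is one-to-one and $S$ is a set of exactly $h$ (nonempty) connected subsets of $\mathbb R^2$, called obstacles, such that for all $u\neq w$ in $V$ we have $uw\in E$ if and only if the open line segment with endpoints $\varphi(u)$ and $\varphi(w)$ meets no obstacle in $S$. \textbf{Lemma.} Let $n,h\ge 0$ be integers, let $G$ be a simple graph with vertex set $V=\{1,\dots,n\}$, and let $\varphi_1,\varphi_2:V\to\mathbb R^2$ be one-to-one maps such that $(\varphi_1(1),\dots,\varphi_1(n))$ and $(\varphi_2(1),\dots,\varphi_2(n))$ have the same super-order type. Assume that no two of the points $\varphi_1(1),\dots,\varphi_1(n)$ have the same $x$-coordinate and, if $n\ge 3$, that these points do not all lie on one line. If $G$ has an $h$-obstacle representation $(\varphi_1,S_1)$, then it also has an $h$-obstacle representation $(\varphi_2,S_2)$. -/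

import Mathlib

namespace ObstacleNumber

/-- The plane `ℝ²` (only its topology and its affine structure are used). -/
abbrev Plane : Type := ℝ × ℝ

/-- A sextuple `⟨a₁, a₂, b₁, b₂, c₁, c₂⟩` of elements of `ι` (indices or points). -/
structure Sextuple (ι : Type*) where
  a₁ : ι
  a₂ : ι
  b₁ : ι
  b₂ : ι
  c₁ : ι
  c₂ : ι

namespace Sextuple

/-- Apply a map to all six entries. -/
def map {ι κ : Type*} (f : ι → κ) (T : Sextuple ι) : Sextuple κ :=
  ⟨f T.a₁, f T.a₂, f T.b₁, f T.b₂, f T.c₁, f T.c₂⟩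

/-- Admissible sextuples: three pairwise different two-element sets without an element common to
all three. -/
structure Admissible {ι : Type*} (T : Sextuple ι) : Prop where
  a_ne : T.a₁ ≠ T.a₂
  b_ne : T.b₁ ≠ T.b₂
  c_ne : T.c₁ ≠ T.c₂
  ab_ne : ({T.a₁, T.a₂} : Set ι) ≠ {T.b₁, T.b₂}
  bc_ne : ({T.b₁, T.b₂} : Set ι) ≠ {T.c₁, T.c₂}
  ca_ne : ({T.c₁, T.c₂} : Set ι) ≠ {T.a₁, T.a₂}
  inter_eq_empty : ({T.a₁, T.a₂} ∩ {T.b₁, T.b₂} ∩ {T.c₁, T.c₂} : Set ι) = ∅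

/-- The line `A` through `a₁` and `a₂`. -/
noncomputable def lineA (T : Sextuple Plane) : AffineSubspace ℝ Plane := line[ℝ, T.a₁, T.a₂]

/-- The line `B` through `b₁` and `b₂`. -/
noncomputable def lineB (T : Sextuple Plane) : AffineSubspace ℝ Plane := line[ℝ, T.b₁, T.b₂]

/-- The line `C` through `c₁` and `c₂`. -/
noncomputable def lineC (T : Sextuple Plane) : AffineSubspace ℝ Plane := line[ℝ, T.c₁, T.c₂]

/-- One of `A`, `B`, `C` is vertical, or `A` is parallel to `B` or to `C`, or `A`, `B`, `C` have a
common point. -/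
def Degenerate (T : Sextuple Plane) : Prop :=
  (T.a₁.1 = T.a₂.1 ∨ T.b₁.1 = T.b₂.1 ∨ T.c₁.1 = T.c₂.1) ∨
  (T.lineA.Parallel T.lineB ∨ T.lineA.Parallel T.lineC) ∨
  ∃ p, p ∈ T.lineA ∧ p ∈ T.lineB ∧ p ∈ T.lineC

/-- `A ∩ B` comes before `A ∩ C` on the line `A`, directed from `a₁` towards `a₂`. The points of
`A` are parametrized as `a₁ + t (a₂ - a₁)`. -/
def Before (T : Sextuple Plane) : Prop :=
  ∃ s t : ℝ, AffineMap.lineMap T.a₁ T.a₂ s ∈ T.lineB ∧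
    AffineMap.lineMap T.a₁ T.a₂ t ∈ T.lineC ∧ s < t

open Classical in
/-- The type of a sextuple of points: `0` if it is degenerate, and otherwise `-1` or `+1` as
`A ∩ B` comes before or after `A ∩ C` on `A`. -/
noncomputable def type (T : Sextuple Plane) : SignType :=
  if T.Degenerate then 0 else if T.Before then -1 else 1

end Sextuple

/-- The super-order type of a sequence of points: the family of the types of all sextuples of
points with an admissible sextuple of indices. -/
noncomputable def superOrderType {n : ℕ} (φ : Fin n → Plane) :
    {T : Sextuple (Fin n) // T.Admissible} → SignType :=
  fun T => (T.1.map φ).type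

/-- `(φ, S)` is an obstacle representation of `G`: `φ` is one-to-one, every obstacle is a
(nonempty) connected set, and two different vertices are adjacent if and only if the open segment
between their images meets no obstacle. -/
structure IsObstacleRepresentation {V : Type*} (G : SimpleGraph V) (φ : V → Plane)
    (S : Set (Set Plane)) : Prop where
  injective : Function.Injective φ
  isConnected : ∀ X ∈ S, IsConnected X
  adj_iff : ∀ u w : V, u ≠ w →
    (G.Adj u w ↔ ∀ X ∈ S, Disjoint (openSegment ℝ (φ u) (φ w)) X)

/-- An `h`-obstacle representation: an obstacle representation with exactly `h` obstacles. -/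
structure IsHObstacleRepresentation {V : Type*} (h : ℕ) (G : SimpleGraph V) (φ : V → Plane)
    (S : Set (Set Plane)) : Prop extends IsObstacleRepresentation G φ S where
  encard_eq : S.encard = h

end ObstacleNumber

/-! The lines through pairs of points cut the plane into cells (of dimensions 0, 1 and 2), each
given by the signs of the functions `side`. The super-order type records the order in which the
lines cross each given line. This determines collinearity, parallelism (`Similar.turn_ne_zero`) and,
up to one reflection of the whole plane, the orientations of all triangles
(`Similar.exists_factor`); the sign of a factor `e` absorbs the reflection.

Hence every sign vector realized by a point for `φ` is realized for `ψ` (`Similar.cell_nonempty`).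
Replace each obstacle by the union of the cells of `ψ` that correspond to the cells it meets. These
unions are connected (`isConnected_transfer`), and they block the same segments, because lying on an
open segment between two vertices depends only on the sign vector (`Similar.disjoint_transfer_iff`).

Distinct obstacles may get the same image, so only an upper bound on their number survives; harmless
obstacles make up the difference. With fewer than three points there is no triangle to use, and at
most one segment has to be blocked. -/

namespace ObstacleNumber

/-! ### Signed areas, and the type of a sextuple as the sign of a difference of parameters. -/

/-- Twice the signed area of the triangle `a b p`; it vanishes if and only if `p` lies on the line
through `a` and `b`. -/
def side (a b p : Plane) : ℝ := (b.1 - a.1) * (p.2 - a.2) - (b.2 - a.2) * (p.1 - a.1)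

/-- The cross product of the vectors `b - a` and `d - c`. -/
def turn (a b c d : Plane) : ℝ := (b.1 - a.1) * (d.2 - c.2) - (b.2 - a.2) * (d.1 - c.1)

/-- The position on the line `a₁ a₂` of its intersection with the line `b₁ b₂`. -/
noncomputable def param (a₁ a₂ b₁ b₂ : Plane) : ℝ := -side b₁ b₂ a₁ / turn b₁ b₂ a₁ a₂

theorem turn_swap (a b c d : Plane) : turn c d a b = -turn a b c d := by
  simp only [turn]; ring

theorem side_lineMap (a b c d : Plane) (t : ℝ) :
    side a b (AffineMap.lineMap c d t) = side a b c + t * turn a b c d := by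
  simp [side, turn, AffineMap.lineMap_apply]; ring

theorem side_combo (a b p q : Plane) (s t : ℝ) (h : s + t = 1) :
    side a b (s • p + t • q) = s * side a b p + t * side a b q := by
  obtain rfl : t = 1 - s := by linarith
  simp [side]; ring

theorem side_lineMap_of_turn_ne_zero {a b c d : Plane} (h : turn a b c d ≠ 0) (t : ℝ) :
    side a b (AffineMap.lineMap c d t) = (t - param c d a b) * turn a b c d := by
  rw [side_lineMap, param]; field_simp; ring

theorem side_left_eq {a b c d : Plane} (h : turn a b c d ≠ 0) :
    side a b c = -param c d a b * turn a b c d := by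
  simpa using side_lineMap_of_turn_ne_zero h 0

theorem side_right_eq {a b c d : Plane} (h : turn a b c d ≠ 0) :
    side a b d = (1 - param c d a b) * turn a b c d := by
  simpa using side_lineMap_of_turn_ne_zero h 1

theorem side_sub_side (a b c d : Plane) : side a b d - side a b c = turn a b c d := by
  simp only [side, turn]; ring

theorem side_swap (a b p : Plane) : side b a p = -side a b p := by
  simp only [side]; ring

theorem side_rotate (a b p : Plane) : side b p a = side a b p := by
  simp only [side]; ring

@[simp] theorem side_self_left (a b : Plane) : side a b a = 0 := by simp [side]

@[simp] theorem side_self_right (a b : Plane) : side a b b = 0 := by simp [side]; ring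

@[simp] theorem side_self (a p : Plane) : side a a p = 0 := by simp [side]

theorem side_eq_zero_iff {a b p : Plane} (h : a ≠ b) :
    side a b p = 0 ↔ ∃ t : ℝ, AffineMap.lineMap a b t = p := by
  constructor
  · intro hs
    by_cases h1 : b.1 - a.1 = 0
    · have h2 : b.2 - a.2 ≠ 0 := fun h2 => h (Prod.ext (by linarith) (by linarith))
      refine ⟨(p.2 - a.2) / (b.2 - a.2), ?_⟩
      have : p.1 - a.1 = 0 := by simpa [side, h1, h2] using hs
      ext
      · simp [AffineMap.lineMap_apply, h1]; linarith
      · simp [AffineMap.lineMap_apply]; field_simp; ring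
    · refine ⟨(p.1 - a.1) / (b.1 - a.1), ?_⟩
      unfold side at hs
      ext
      · simp [AffineMap.lineMap_apply]; field_simp; ring
      · simp [AffineMap.lineMap_apply]; field_simp; linarith
  · rintro ⟨t, rfl⟩
    rw [side_lineMap]
    simp only [side_self_left, turn]; ring

theorem mem_line_iff {a b p : Plane} (h : a ≠ b) : p ∈ line[ℝ, a, b] ↔ side a b p = 0 := by
  rw [side_eq_zero_iff h, mem_affineSpan_pair_iff_exists_lineMap_eq]

theorem turn_eq_zero_iff_parallel {a b c d : Plane} (h : a ≠ b) (h' : c ≠ d) :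
    turn a b c d = 0 ↔ line[ℝ, a, b].Parallel line[ℝ, c, d] := by
  rw [AffineSubspace.affineSpan_pair_parallel_iff_vectorSpan_eq, vectorSpan_pair_rev,
    vectorSpan_pair_rev]
  constructor
  · intro ht
    have hs : side a b (a + (d -ᵥ c)) = 0 := by
      rw [← ht]; simp [side, turn]
    obtain ⟨t, ht⟩ := (side_eq_zero_iff h).1 hs
    have e : d -ᵥ c = t • (b -ᵥ a) := by
      simp [AffineMap.lineMap_apply] at ht ⊢
      have := congrArg (· - a) ht
      simp at this
      simpa using this.symm
    have t0 : t ≠ 0 := by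
      rintro rfl
      simp [sub_eq_zero] at e
      exact h' e.symm
    rw [e, Submodule.span_singleton_smul_eq (IsUnit.mk0 t t0)]
  · intro hs
    have : d -ᵥ c ∈ Submodule.span ℝ {b -ᵥ a} := by
      rw [hs]; exact Submodule.mem_span_singleton_self _
    obtain ⟨t, ht⟩ := Submodule.mem_span_singleton.1 this
    have e1 : d.1 - c.1 = t * (b.1 - a.1) := by simpa using (congrArg Prod.fst ht).symm
    have e2 : d.2 - c.2 = t * (b.2 - a.2) := by simpa using (congrArg Prod.snd ht).symm
    simp only [turn, e1, e2]; ring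

theorem Sextuple.turn_ne_zero_of_type_ne_zero {T : Sextuple Plane} (h : T.type ≠ 0) :
    T.a₁.1 ≠ T.a₂.1 ∧ T.b₁.1 ≠ T.b₂.1 ∧ T.c₁.1 ≠ T.c₂.1 ∧
      turn T.b₁ T.b₂ T.a₁ T.a₂ ≠ 0 ∧ turn T.c₁ T.c₂ T.a₁ T.a₂ ≠ 0 := by
  have hd : ¬ T.Degenerate := fun hd => h (by simp [Sextuple.type, hd])
  simp only [Sextuple.Degenerate, not_or] at hd
  obtain ⟨⟨ha, hb, hc⟩, ⟨hab, hac⟩, -⟩ := hd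
  have ne {p q : Plane} (h : p.1 ≠ q.1) : p ≠ q := fun e => h (congrArg _ e)
  refine ⟨ha, hb, hc, ?_, ?_⟩
  · rw [turn_swap, neg_ne_zero, Ne, turn_eq_zero_iff_parallel (ne ha) (ne hb)]; exact hab
  · rw [turn_swap, neg_ne_zero, Ne, turn_eq_zero_iff_parallel (ne ha) (ne hc)]; exact hac

/-- Under these hypotheses `B` and `C` each meet `A` in exactly one point, and degeneracy can only
mean that the two points coincide. -/
theorem Sextuple.type_eq_sign {T : Sextuple Plane} (ha : T.a₁.1 ≠ T.a₂.1)
    (hb : T.b₁.1 ≠ T.b₂.1) (hc : T.c₁.1 ≠ T.c₂.1) (hab : turn T.b₁ T.b₂ T.a₁ T.a₂ ≠ 0)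
    (hac : turn T.c₁ T.c₂ T.a₁ T.a₂ ≠ 0) :
    T.type = SignType.sign (param T.a₁ T.a₂ T.b₁ T.b₂ - param T.a₁ T.a₂ T.c₁ T.c₂) := by
  have ne {p q : Plane} (h : p.1 ≠ q.1) : p ≠ q := fun e => h (congrArg _ e)
  have memB (t : ℝ) : AffineMap.lineMap T.a₁ T.a₂ t ∈ T.lineB ↔ t = param T.a₁ T.a₂ T.b₁ T.b₂ := by
    rw [Sextuple.lineB, mem_line_iff (ne hb), side_lineMap_of_turn_ne_zero hab, mul_eq_zero,
      sub_eq_zero, or_iff_left hab]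
  have memC (t : ℝ) : AffineMap.lineMap T.a₁ T.a₂ t ∈ T.lineC ↔ t = param T.a₁ T.a₂ T.c₁ T.c₂ := by
    rw [Sextuple.lineC, mem_line_iff (ne hc), side_lineMap_of_turn_ne_zero hac, mul_eq_zero,
      sub_eq_zero, or_iff_left hac]
  have hd : T.Degenerate ↔ param T.a₁ T.a₂ T.b₁ T.b₂ = param T.a₁ T.a₂ T.c₁ T.c₂ := by
    have hab' : ¬ T.lineA.Parallel T.lineB := by
      rw [turn_swap, neg_ne_zero, Ne, turn_eq_zero_iff_parallel (ne ha) (ne hb)] at hab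
      exact hab
    have hac' : ¬ T.lineA.Parallel T.lineC := by
      rw [turn_swap, neg_ne_zero, Ne, turn_eq_zero_iff_parallel (ne ha) (ne hc)] at hac
      exact hac
    simp only [Sextuple.Degenerate, ha, hb, hc, hab', hac', false_or]
    constructor
    · rintro ⟨p, hA, hB, hC⟩
      obtain ⟨t, rfl⟩ := mem_affineSpan_pair_iff_exists_lineMap_eq.1 hA
      rw [← (memB t).1 hB, ← (memC t).1 hC]
    · intro h
      exact ⟨AffineMap.lineMap T.a₁ T.a₂ (param T.a₁ T.a₂ T.b₁ T.b₂),
        AffineMap.lineMap_mem_affineSpan_pair _ _ _, (memB _).2 rfl, (memC _).2 h⟩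
  have hB : T.Before ↔ param T.a₁ T.a₂ T.b₁ T.b₂ < param T.a₁ T.a₂ T.c₁ T.c₂ := by
    simp only [Sextuple.Before, memB, memC]
    exact ⟨by rintro ⟨s, t, rfl, rfl, h⟩; exact h, fun h => ⟨_, _, rfl, rfl, h⟩⟩
  rw [Sextuple.type]
  split_ifs with h1 h2
  · rw [hd.1 h1]; simp
  · rw [sign_neg (by linarith [hB.1 h2])]
  · rw [sign_pos]
    rcases lt_trichotomy (param T.a₁ T.a₂ T.b₁ T.b₂) (param T.a₁ T.a₂ T.c₁ T.c₂) with h | h | h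
    · exact absurd (hB.2 h) h2
    · exact absurd (hd.2 h) h1
    · linarith

open SignType (sign)

/-! ### What triangles transfer: collinearity and the absence of vertical lines. -/

/-- The hypotheses on two point sequences: the same super-order type, no vertical line through
two of the points, and no line containing all of them. -/
structure Similar {n : ℕ} (φ ψ : Fin n → Plane) : Prop where
  fst_ne_left : ∀ i j, i ≠ j → (φ i).1 ≠ (φ j).1
  fst_ne_right : ∀ i j, i ≠ j → (ψ i).1 ≠ (ψ j).1
  exists_side_left : ∀ i j, i ≠ j → ∃ k, side (φ i) (φ j) (φ k) ≠ 0
  exists_side_right : ∀ i j, i ≠ j → ∃ k, side (ψ i) (ψ j) (ψ k) ≠ 0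
  superOrderType_eq : superOrderType φ = superOrderType ψ

theorem type_map_eq {n : ℕ} {φ ψ : Fin n → Plane} (h : superOrderType φ = superOrderType ψ)
    (T : Sextuple (Fin n)) (hT : T.Admissible) : (T.map φ).type = (T.map ψ).type :=
  congrFun h ⟨T, hT⟩

theorem admissible_of {ι : Type*} {i j k l k' l' : ι} (hij : i ≠ j) (hkl : k ≠ l)
    (hkl' : k' ≠ l') (h₁ : ¬ ((i = k ∧ j = l) ∨ (i = l ∧ j = k)))
    (h₂ : ¬ ((k = k' ∧ l = l') ∨ (k = l' ∧ l = k')))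
    (h₃ : ¬ ((k' = i ∧ l' = j) ∨ (k' = j ∧ l' = i)))
    (hi : ¬ ((i = k ∨ i = l) ∧ (i = k' ∨ i = l')))
    (hj : ¬ ((j = k ∨ j = l) ∧ (j = k' ∨ j = l'))) :
    (⟨i, j, k, l, k', l'⟩ : Sextuple ι).Admissible := by
  refine ⟨hij, hkl, hkl', ?_, ?_, ?_, ?_⟩
  · rwa [Ne, Set.pair_eq_pair_iff]
  · rwa [Ne, Set.pair_eq_pair_iff]
  · rwa [Ne, Set.pair_eq_pair_iff]
  · refine Set.eq_empty_of_forall_notMem ?_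
    rintro x ⟨⟨rfl | hx, h⟩, h'⟩
    · exact hi ⟨h, h'⟩
    · obtain rfl : x = j := hx
      exact hj ⟨h, h'⟩

theorem admissible_triangle {ι : Type*} {i j k : ι} (hij : i ≠ j) (hik : i ≠ k) (hjk : j ≠ k) :
    (⟨i, j, i, k, j, k⟩ : Sextuple ι).Admissible := by
  apply admissible_of <;> grind

theorem ne_of_side_ne_zero {a b p : Plane} (h : side a b p ≠ 0) : a ≠ b ∧ a ≠ p ∧ b ≠ p := by
  refine ⟨?_, ?_, ?_⟩ <;> rintro rfl <;> simp at h

/-- The other two sides meet the line `a b` at the parameters 0 and 1. -/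
theorem type_triangle {a b c : Plane} (hab : a.1 ≠ b.1) (hac : a.1 ≠ c.1) (hbc : b.1 ≠ c.1)
    (h : side a b c ≠ 0) : (⟨a, b, a, c, b, c⟩ : Sextuple Plane).type = -1 := by
  have h1 : turn a c a b ≠ 0 := by
    convert neg_ne_zero.2 h using 1; simp only [side, turn]; ring
  have h2 : turn b c a b ≠ 0 := by
    convert neg_ne_zero.2 h using 1; simp only [side, turn]; ring
  rw [Sextuple.type_eq_sign hab hac hbc h1 h2]
  have e1 := side_left_eq h1
  have e2 := side_right_eq h2
  simp [h1] at e1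
  simp [h2] at e2
  simp only [e1]
  rw [sign_neg]
  linarith

/-- The triangle has nonzero type for `φ`, hence for `ψ`; a nonzero type excludes vertical and
parallel sides. -/
theorem fst_ne_and_side_ne_zero {n : ℕ} {φ ψ : Fin n → Plane}
    (hσ : superOrderType φ = superOrderType ψ) (hx : ∀ i j, i ≠ j → (φ i).1 ≠ (φ j).1)
    {i j k : Fin n} (h : side (φ i) (φ j) (φ k) ≠ 0) :
    (ψ i).1 ≠ (ψ j).1 ∧ side (ψ i) (ψ j) (ψ k) ≠ 0 := by
  obtain ⟨h1, h2, h3⟩ := ne_of_side_ne_zero h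
  replace h1 : i ≠ j := fun e => h1 (congrArg φ e)
  replace h2 : i ≠ k := fun e => h2 (congrArg φ e)
  replace h3 : j ≠ k := fun e => h3 (congrArg φ e)
  have ht := type_map_eq hσ _ (admissible_triangle h1 h2 h3)
  simp only [Sextuple.map] at ht
  rw [type_triangle (hx _ _ h1) (hx _ _ h2) (hx _ _ h3) h] at ht
  obtain ⟨h4, -, -, h5, -⟩ := Sextuple.turn_ne_zero_of_type_ne_zero
    (T := ⟨ψ i, ψ j, ψ i, ψ k, ψ j, ψ k⟩) (by rw [← ht]; decide)
  refine ⟨h4, ?_⟩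
  convert neg_ne_zero.2 h5 using 1
  simp only [side, turn]; ring

theorem exists_side_ne_zero {ι : Type*} {φ : ι → Plane} (hc : ¬ Collinear ℝ (Set.range φ))
    {i j : ι} (h : φ i ≠ φ j) : ∃ k, side (φ i) (φ j) (φ k) ≠ 0 := by
  by_contra! hk
  refine hc ((collinear_iff_exists_forall_eq_smul_vadd _).2 ⟨φ i, φ j -ᵥ φ i, ?_⟩)
  rintro _ ⟨k, rfl⟩
  obtain ⟨t, ht⟩ := (side_eq_zero_iff h).1 (hk k)
  exact ⟨t, by rw [← ht, AffineMap.lineMap_apply]⟩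

/-- Every pair of indices is a side of some nondegenerate triangle, so the assumptions on `φ` pass
to `ψ`. This makes the relation symmetric, and later implications can be reversed. -/
theorem Similar.of_not_collinear {n : ℕ} {φ ψ : Fin n → Plane}
    (hx : ∀ i j, i ≠ j → (φ i).1 ≠ (φ j).1) (hc : ¬ Collinear ℝ (Set.range φ))
    (hσ : superOrderType φ = superOrderType ψ) : Similar φ ψ := by
  have ex (i j : Fin n) (h : i ≠ j) : ∃ k, side (φ i) (φ j) (φ k) ≠ 0 :=
    exists_side_ne_zero hc fun e => hx i j h (congrArg _ e)
  refine ⟨hx, fun i j h => ?_, ex, fun i j h => ?_, hσ⟩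
  · obtain ⟨k, hk⟩ := ex i j h
    exact (fst_ne_and_side_ne_zero hσ hx hk).1
  · obtain ⟨k, hk⟩ := ex i j h
    exact ⟨k, (fst_ne_and_side_ne_zero hσ hx hk).2⟩

/-! ### Parallelism and the order of the crossings on a line. -/

namespace Similar

variable {n : ℕ} {φ ψ : Fin n → Plane}

theorem symm (H : Similar φ ψ) : Similar ψ φ :=
  ⟨H.fst_ne_right, H.fst_ne_left, H.exists_side_right, H.exists_side_left,
    H.superOrderType_eq.symm⟩

theorem side_ne_zero (H : Similar φ ψ) {i j k : Fin n} (h : side (φ i) (φ j) (φ k) ≠ 0) :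
    side (ψ i) (ψ j) (ψ k) ≠ 0 :=
  (fst_ne_and_side_ne_zero H.superOrderType_eq H.fst_ne_left h).2

theorem index_ne {i j k : Fin n} (h : side (φ i) (φ j) (φ k) ≠ 0) : i ≠ j ∧ i ≠ k ∧ j ≠ k := by
  obtain ⟨h1, h2, h3⟩ := ne_of_side_ne_zero h
  exact ⟨fun e => h1 (congrArg φ e), fun e => h2 (congrArg φ e), fun e => h3 (congrArg φ e)⟩

/-- Use the third line `i k`: it meets the line `i j` at parameter 0, whereas the line `k l` misses
`i`. The sextuple thus has nonzero type, which survives in `ψ` and excludes parallel lines there. -/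
theorem turn_ne_zero_of_side_ne_zero (H : Similar φ ψ) {i j k l : Fin n}
    (h : turn (φ k) (φ l) (φ i) (φ j) ≠ 0) (hi : side (φ k) (φ l) (φ i) ≠ 0)
    (hk : side (φ i) (φ j) (φ k) ≠ 0) : turn (ψ k) (ψ l) (ψ i) (ψ j) ≠ 0 := by
  obtain ⟨hkl, hki, hli⟩ := index_ne hi
  obtain ⟨hij, -, hjk⟩ := index_ne hk
  have hT : (⟨i, j, k, l, i, k⟩ : Sextuple (Fin n)).Admissible := by
    clear h hi hk
    apply admissible_of <;> grind
  have ht := type_map_eq H.superOrderType_eq _ hT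
  simp only [Sextuple.map] at ht
  have hik : turn (φ i) (φ k) (φ i) (φ j) ≠ 0 := by
    convert neg_ne_zero.2 hk using 1; simp only [side, turn]; ring
  rw [Sextuple.type_eq_sign (H.fst_ne_left _ _ hij) (H.fst_ne_left _ _ hkl)
    (H.fst_ne_left _ _ hki.symm) h hik] at ht
  have e1 := side_left_eq hik
  simp [hik] at e1
  have e2 := side_left_eq h
  refine (Sextuple.turn_ne_zero_of_type_ne_zero
    (T := ⟨ψ i, ψ j, ψ k, ψ l, ψ i, ψ k⟩) ?_).2.2.2.1
  rw [← ht]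
  simp only [e1, sub_zero, ne_eq, sign_eq_zero_iff]
  intro h0
  simp [h0] at e2
  exact hi e2

/-- If the lines are not parallel, at least one of `i`, `j` is off the line `k l` and at least one
of `k`, `l` is off the line `i j`; exchanging names reduces to the previous lemma. -/
theorem turn_ne_zero (H : Similar φ ψ) {i j k l : Fin n}
    (h : turn (φ k) (φ l) (φ i) (φ j) ≠ 0) : turn (ψ k) (ψ l) (ψ i) (ψ j) ≠ 0 := by
  have flip₁ (φ : Fin n → Plane) (i j k l : Fin n) :
      turn (φ k) (φ l) (φ j) (φ i) = -turn (φ k) (φ l) (φ i) (φ j) := by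
    simp only [turn]; ring
  have flip₂ (φ : Fin n → Plane) (i j k l : Fin n) :
      turn (φ l) (φ k) (φ i) (φ j) = -turn (φ k) (φ l) (φ i) (φ j) := by
    simp only [turn]; ring
  have e1 := side_sub_side (φ k) (φ l) (φ i) (φ j)
  have key {i j k : Fin n} (hi : side (φ k) (φ l) (φ i) ≠ 0)
      (h : turn (φ k) (φ l) (φ i) (φ j) ≠ 0) : turn (ψ k) (ψ l) (ψ i) (ψ j) ≠ 0 := by
    by_cases hk : side (φ i) (φ j) (φ k) = 0
    · have hl : side (φ i) (φ j) (φ l) ≠ 0 := by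
        intro hl
        have e2 := side_sub_side (φ i) (φ j) (φ k) (φ l)
        rw [turn_swap, hk, hl] at e2
        apply h; linarith
      have := H.turn_ne_zero_of_side_ne_zero (i := i) (j := j) (k := l) (l := k)
        (by rw [flip₂]; exact neg_ne_zero.2 h) (by rw [side_swap]; exact neg_ne_zero.2 hi) hl
      rw [flip₂] at this
      exact neg_ne_zero.1 this
    · exact H.turn_ne_zero_of_side_ne_zero h hi hk
  by_cases hi : side (φ k) (φ l) (φ i) = 0
  · have hj : side (φ k) (φ l) (φ j) ≠ 0 := by
      intro hj; rw [hi, hj] at e1; apply h; linarith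
    have := key hj (j := i) (by rw [flip₁]; exact neg_ne_zero.2 h)
    rw [flip₁] at this
    exact neg_ne_zero.1 this
  · exact key hi h

/-- The inadmissible cases hold for trivial reasons: either the two crossing lines are the same, or
both pass through `i` (parameter 0) or both through `j` (parameter 1). -/
theorem sign_param_sub_param (H : Similar φ ψ) {i j k l k' l' : Fin n}
    (h : turn (φ k) (φ l) (φ i) (φ j) ≠ 0) (h' : turn (φ k') (φ l') (φ i) (φ j) ≠ 0) :
    sign (param (φ i) (φ j) (φ k) (φ l) - param (φ i) (φ j) (φ k') (φ l')) =
      sign (param (ψ i) (ψ j) (ψ k) (ψ l) - param (ψ i) (ψ j) (ψ k') (ψ l')) := by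
  have g := H.turn_ne_zero h
  have g' := H.turn_ne_zero h'
  have hij : i ≠ j := by rintro rfl; simp [turn] at h
  have hkl : k ≠ l := by rintro rfl; simp [turn] at h
  have hkl' : k' ≠ l' := by rintro rfl; simp [turn] at h'
  by_cases hT : (⟨i, j, k, l, k', l'⟩ : Sextuple (Fin n)).Admissible
  · have ht := type_map_eq H.superOrderType_eq _ hT
    simp only [Sextuple.map] at ht
    rwa [Sextuple.type_eq_sign (H.fst_ne_left _ _ hij) (H.fst_ne_left _ _ hkl)
      (H.fst_ne_left _ _ hkl') h h', Sextuple.type_eq_sign (H.fst_ne_right _ _ hij)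
      (H.fst_ne_right _ _ hkl) (H.fst_ne_right _ _ hkl') g g'] at ht
  have zero {χ : Fin n → Plane} {k l : Fin n} (hi : i = k ∨ i = l) :
      param (χ i) (χ j) (χ k) (χ l) = 0 := by
    rcases hi with rfl | rfl <;> simp [param]
  have one {χ : Fin n → Plane} {k l : Fin n} (h : turn (χ k) (χ l) (χ i) (χ j) ≠ 0)
      (hj : j = k ∨ j = l) : param (χ i) (χ j) (χ k) (χ l) = 1 := by
    have e := side_right_eq h
    have : side (χ k) (χ l) (χ j) = 0 := by rcases hj with rfl | rfl <;> simp
    rw [this, eq_comm, mul_eq_zero, or_iff_left h] at e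
    linarith
  have swap (χ : Fin n → Plane) (k l : Fin n) :
      param (χ i) (χ j) (χ l) (χ k) = param (χ i) (χ j) (χ k) (χ l) := by
    have : turn (χ l) (χ k) (χ i) (χ j) = -turn (χ k) (χ l) (χ i) (χ j) := by
      simp only [turn]; ring
    rw [param, param, this, side_swap, neg_neg, div_neg, neg_div]
  have parallel {k l : Fin n} (h : turn (φ k) (φ l) (φ i) (φ j) ≠ 0) :
      ¬ ((k = i ∧ l = j) ∨ (k = j ∧ l = i)) := by
    rintro (⟨rfl, rfl⟩ | ⟨rfl, rfl⟩) <;> apply h <;> simp only [turn] <;> ring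
  by_cases hi : (i = k ∨ i = l) ∧ (i = k' ∨ i = l')
  · simp only [zero hi.1, zero hi.2]
  by_cases hj : (j = k ∨ j = l) ∧ (j = k' ∨ j = l')
  · simp only [one h hj.1, one h' hj.2, one g hj.1, one g' hj.2]
  by_cases hk : (k = k' ∧ l = l') ∨ (k = l' ∧ l = k')
  · rcases hk with ⟨rfl, rfl⟩ | ⟨rfl, rfl⟩
    · simp
    · simp only [swap _ k l, sub_self]
  refine absurd ?_ hT
  have p1 := parallel h
  have p2 := parallel h'
  clear H h h' g g' zero one swap parallel hT
  apply admissible_of <;> grind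

/-- Compare with a line through `i`, whose parameter is 0; the next lemma uses a line through `j`,
whose parameter is 1. -/
theorem sign_param (H : Similar φ ψ) {i j k l : Fin n}
    (h : turn (φ k) (φ l) (φ i) (φ j) ≠ 0) :
    sign (param (φ i) (φ j) (φ k) (φ l)) = sign (param (ψ i) (ψ j) (ψ k) (ψ l)) := by
  have hij : i ≠ j := by rintro rfl; simp [turn] at h
  obtain ⟨m, hm⟩ := H.exists_side_left i j hij
  have h' : turn (φ i) (φ m) (φ i) (φ j) ≠ 0 := by
    convert neg_ne_zero.2 hm using 1; simp only [side, turn]; ring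
  have := H.sign_param_sub_param h h'
  simpa [param] using this

theorem sign_one_sub_param (H : Similar φ ψ) {i j k l : Fin n}
    (h : turn (φ k) (φ l) (φ i) (φ j) ≠ 0) :
    sign (1 - param (φ i) (φ j) (φ k) (φ l)) = sign (1 - param (ψ i) (ψ j) (ψ k) (ψ l)) := by
  have hij : i ≠ j := by rintro rfl; simp [turn] at h
  obtain ⟨m, hm⟩ := H.exists_side_left i j hij
  have h' : turn (φ j) (φ m) (φ i) (φ j) ≠ 0 := by
    convert neg_ne_zero.2 hm using 1; simp only [side, turn]; ring
  have one {χ : Fin n → Plane} (h : turn (χ j) (χ m) (χ i) (χ j) ≠ 0) :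
      param (χ i) (χ j) (χ j) (χ m) = 1 := by
    have e := side_right_eq h
    rw [side_self_left, eq_comm, mul_eq_zero, or_iff_left h] at e
    linarith
  have := H.sign_param_sub_param h' h
  rwa [one h', one (H.turn_ne_zero h')] at this

/-! ### Orientations agree up to one global sign. -/

/-- The product of the orientations of corresponding triangles. -/
def orient (φ ψ : Fin n → Plane) (i j k : Fin n) : ℝ :=
  side (φ i) (φ j) (φ k) * side (ψ i) (ψ j) (ψ k)

theorem orient_rotate (φ ψ : Fin n → Plane) (i j k : Fin n) :
    orient φ ψ j k i = orient φ ψ i j k := by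
  simp only [orient, side_rotate]

theorem orient_swap (φ ψ : Fin n → Plane) (i j k : Fin n) :
    orient φ ψ j i k = orient φ ψ i j k := by
  rw [orient, side_swap, side_swap (ψ i), orient]; ring

theorem orient_ne_zero (H : Similar φ ψ) {i j k : Fin n} (h : side (φ i) (φ j) (φ k) ≠ 0) :
    orient φ ψ i j k ≠ 0 :=
  mul_ne_zero h (H.side_ne_zero h)

/-- Whether the line `i j` separates `k` from `l` is read off from its crossing parameter `t` on the
line `k l`: the product of the two sides has the sign of `-t * (1 - t)`. -/
theorem orient_mul_pos_of_common_pair (H : Similar φ ψ) {i j k l : Fin n}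
    (hk : orient φ ψ i j k ≠ 0) (hl : orient φ ψ i j l ≠ 0) :
    0 < orient φ ψ i j k * orient φ ψ i j l := by
  have e : orient φ ψ i j k * orient φ ψ i j l =
      (side (φ i) (φ j) (φ k) * side (φ i) (φ j) (φ l)) *
        (side (ψ i) (ψ j) (ψ k) * side (ψ i) (ψ j) (ψ l)) := by
    simp only [orient]; ring
  have hne := mul_ne_zero hk hl
  rw [e] at hne ⊢
  have hs : sign (side (φ i) (φ j) (φ k) * side (φ i) (φ j) (φ l)) =
      sign (side (ψ i) (ψ j) (ψ k) * side (ψ i) (ψ j) (ψ l)) := by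
    by_cases h : turn (φ i) (φ j) (φ k) (φ l) = 0
    · have h' : turn (ψ i) (ψ j) (ψ k) (ψ l) = 0 := by
        by_contra h'; exact H.symm.turn_ne_zero h' h
      have e1 := side_sub_side (φ i) (φ j) (φ k) (φ l)
      have e2 := side_sub_side (ψ i) (ψ j) (ψ k) (ψ l)
      rw [h, sub_eq_zero] at e1
      rw [h', sub_eq_zero] at e2
      rw [e1, e2] at hne ⊢
      have h1 : 0 < side (φ i) (φ j) (φ k) * side (φ i) (φ j) (φ k) :=
        mul_self_pos.2 (by rintro h0; simp [h0] at hne)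
      have h2 : 0 < side (ψ i) (ψ j) (ψ k) * side (ψ i) (ψ j) (ψ k) :=
        mul_self_pos.2 (by rintro h0; simp [h0] at hne)
      rw [sign_pos h1, sign_pos h2]
    · have h' := H.turn_ne_zero h
      rw [side_left_eq h, side_left_eq h', side_right_eq h, side_right_eq h']
      have sq {t d : ℝ} (hd : d ≠ 0) :
          sign (-t * d * ((1 - t) * d)) = -(sign t * sign (1 - t)) := by
        have : -t * d * ((1 - t) * d) = -(t * (1 - t)) * (d * d) := by ring
        rw [this, sign_mul, sign_pos (mul_self_pos.2 hd), mul_one, Left.sign_neg, sign_mul]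
      rw [sq h, sq h', H.sign_param h, H.sign_one_sub_param h]
  have hs' : sign ((side (φ i) (φ j) (φ k) * side (φ i) (φ j) (φ l)) *
        (side (ψ i) (ψ j) (ψ k) * side (ψ i) (ψ j) (ψ l))) = 1 := by
    rw [sign_mul, ← hs, ← sign_mul, sign_pos (mul_self_pos.2 (left_ne_zero_of_mul hne))]
  exact sign_eq_one_iff.1 hs'

theorem _root_.ObstacleNumber.mul_pos_trans {x y z : ℝ} (h : 0 < x * y) (h' : 0 < y * z) :
    0 < x * z := by
  have hy : y ≠ 0 := by rintro rfl; simp at h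
  have : 0 < (x * z) * (y * y) := by nlinarith [mul_pos h h']
  exact pos_of_mul_pos_left this (mul_self_nonneg y)

theorem _root_.ObstacleNumber.eq_of_side_eq_zero {a b p q : Plane} (h : side a b p ≠ 0)
    (ha : side p a q = 0) (hb : side p b q = 0) : p = q := by
  unfold side at h ha hb
  ext
  · refine sub_eq_zero.1 ((mul_eq_zero.1 ?_).resolve_right h)
    linear_combination (a.1 - p.1) * hb - (b.1 - p.1) * ha
  · refine sub_eq_zero.1 ((mul_eq_zero.1 ?_).resolve_right h)
    linear_combination (a.2 - p.2) * hb - (b.2 - p.2) * ha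

/-- Pass from one triangle to the other by exchanging one vertex at a time, keeping every
intermediate triangle nondegenerate. This is possible since `l` is off some side line of the first
triangle, and `m ≠ l` cannot lie on two different lines through `l`. -/
theorem orient_mul_pos (H : Similar φ ψ) {i j k l m p : Fin n}
    (h : side (φ i) (φ j) (φ k) ≠ 0) (h' : side (φ l) (φ m) (φ p) ≠ 0) :
    0 < orient φ ψ i j k * orient φ ψ l m p := by
  have hlm : φ l ≠ φ m := (ne_of_side_ne_zero h').1
  have rot (a b c : Fin n) : orient φ ψ c a b = orient φ ψ a b c := by
    rw [← orient_rotate]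
  have swap_right (a b c : Fin n) : orient φ ψ a c b = orient φ ψ a b c := by
    rw [← orient_rotate, ← orient_rotate, orient_swap, ← rot]
  have from_pair {i j : Fin n} (hl : orient φ ψ i j l ≠ 0) (hm : orient φ ψ l i m ≠ 0) :
      0 < orient φ ψ i j l * orient φ ψ l m p := by
    have p1 := H.orient_mul_pos_of_common_pair (i := l) (j := i) (k := j) (l := m)
      (by rwa [rot]) hm
    have p2 := H.orient_mul_pos_of_common_pair (i := l) (j := m) (k := i) (l := p)
      (by rwa [swap_right]) (H.orient_ne_zero h')
    rw [rot] at p1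
    rw [swap_right] at p2
    exact mul_pos_trans p1 p2
  have from_triple {i j : Fin n} (hl : side (φ i) (φ j) (φ l) ≠ 0) :
      0 < orient φ ψ i j l * orient φ ψ l m p := by
    by_cases hm : side (φ l) (φ i) (φ m) = 0
    · have hm' : side (φ l) (φ j) (φ m) ≠ 0 := fun hm' => hlm (eq_of_side_eq_zero hl hm hm')
      rw [← orient_swap]
      exact from_pair (by rw [orient_swap]; exact H.orient_ne_zero hl) (H.orient_ne_zero hm')
    · exact from_pair (H.orient_ne_zero hl) (H.orient_ne_zero hm)
  have from_base {i j k : Fin n} (h : side (φ i) (φ j) (φ k) ≠ 0)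
      (hl : side (φ i) (φ j) (φ l) ≠ 0) : 0 < orient φ ψ i j k * orient φ ψ l m p :=
    mul_pos_trans (H.orient_mul_pos_of_common_pair (H.orient_ne_zero h) (H.orient_ne_zero hl))
      (from_triple hl)
  by_cases h1 : side (φ i) (φ j) (φ l) = 0
  · by_cases h2 : side (φ j) (φ k) (φ l) = 0
    · have h3 : side (φ k) (φ i) (φ l) ≠ 0 := by
        intro h3
        apply h
        unfold side at *
        linarith
      rw [← rot]
      exact from_base (by rwa [← side_rotate]) h3
    · rw [← orient_rotate]
      exact from_base (by rwa [side_rotate]) h2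
  · exact from_base h h1

theorem exists_factor (H : Similar φ ψ) : ∃ e : ℝ, e ≠ 0 ∧ ∀ i j k,
    sign (side (φ i) (φ j) (φ k)) = sign (e * side (ψ i) (ψ j) (ψ k)) := by
  by_cases hne : ∃ i j k, side (φ i) (φ j) (φ k) ≠ 0
  · obtain ⟨i, j, k, h⟩ := hne
    refine ⟨orient φ ψ i j k, H.orient_ne_zero h, fun l m p => ?_⟩
    by_cases h' : side (φ l) (φ m) (φ p) = 0
    · have : side (ψ l) (ψ m) (ψ p) = 0 := by
        by_contra hc; exact H.symm.side_ne_zero hc h'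
      rw [h', this, mul_zero]
    · have := H.orient_mul_pos h h'
      rw [orient.eq_def φ ψ l, mul_left_comm] at this
      rcases lt_or_gt_of_ne h' with hs | hs
      · rw [sign_neg hs, sign_neg (neg_of_mul_pos_right this hs.le)]
      · rw [sign_pos hs, sign_pos (pos_of_mul_pos_right this hs.le)]
  · push Not at hne
    refine ⟨1, one_ne_zero, fun i j k => ?_⟩
    have : side (ψ i) (ψ j) (ψ k) = 0 := by
      by_contra hc; exact H.symm.side_ne_zero hc (hne i j k)
    rw [hne, this, mul_zero]

theorem sign_turn (H : Similar φ ψ) {e : ℝ}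
    (he : ∀ i j k, sign (side (φ i) (φ j) (φ k)) = sign (e * side (ψ i) (ψ j) (ψ k)))
    (i j k l : Fin n) :
    sign (turn (φ k) (φ l) (φ i) (φ j)) = sign (e * turn (ψ k) (ψ l) (ψ i) (ψ j)) := by
  by_cases h : turn (φ k) (φ l) (φ i) (φ j) = 0
  · have : turn (ψ k) (ψ l) (ψ i) (ψ j) = 0 := by
      by_contra hc; exact H.symm.turn_ne_zero hc h
    rw [h, this, mul_zero]
  have h' := H.turn_ne_zero h
  have hp := H.sign_param h
  by_cases hi : side (φ k) (φ l) (φ i) = 0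
  · have hi' : side (ψ k) (ψ l) (ψ i) = 0 := by
      by_contra hc; exact H.symm.side_ne_zero hc hi
    rw [← side_sub_side, ← side_sub_side, hi, hi', sub_zero, sub_zero, he]
  · have e1 := side_left_eq h
    have e2 := side_left_eq h'
    have hei := he k l i
    rw [e1, e2, sign_mul, mul_left_comm, sign_mul, Left.sign_neg, Left.sign_neg, hp] at hei
    refine mul_left_cancel₀ (a := -sign (param (ψ i) (ψ j) (ψ k) (ψ l))) ?_ hei
    rw [← hp, ← Left.sign_neg, Ne, sign_eq_zero_iff]
    intro h0
    rw [h0, zero_mul] at e1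
    exact hi e1

end Similar

/-! ### Sign lemmas, and segments and first hits in a line arrangement. -/

theorem exists_sign_sub_eq {κ : Type*} [Finite κ] (s s' : κ → ℝ)
    (h : ∀ b c, sign (s b - s c) = sign (s' b - s' c)) (τ : ℝ) :
    ∃ τ', ∀ b, sign (τ - s b) = sign (τ' - s' b) := by
  by_cases hτ : ∃ c, τ = s c
  · obtain ⟨c, rfl⟩ := hτ
    exact ⟨s' c, fun b => h c b⟩
  push Not at hτ
  have hlo : (s' '' {b | s b < τ}).Finite := Set.toFinite _
  have hhi : (s' '' {b | τ < s b}).Finite := Set.toFinite _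
  obtain ⟨τ', h1, h2⟩ := Order.exists_between_finsets hlo.toFinset hhi.toFinset (by
    intro x hx y hy
    obtain ⟨b, hb, rfl⟩ := hlo.mem_toFinset.1 hx
    obtain ⟨c, hc, rfl⟩ := hhi.mem_toFinset.1 hy
    have hbc : s b - s c < 0 := by
      have hb' : s b < τ := hb
      have hc' : τ < s c := hc
      linarith
    have := h b c
    rw [sign_neg hbc, eq_comm, sign_eq_neg_one_iff] at this
    linarith)
  refine ⟨τ', fun b => ?_⟩
  rcases lt_or_gt_of_ne (hτ b) with hb | hb
  · rw [sign_neg (by linarith), sign_neg]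
    linarith [h2 (s' b) (hhi.mem_toFinset.2 ⟨b, hb, rfl⟩)]
  · rw [sign_pos (by linarith), sign_pos]
    linarith [h1 (s' b) (hlo.mem_toFinset.2 ⟨b, hb, rfl⟩)]

theorem nonneg_iff_of_sign_eq {x y : ℝ} (h : sign x = sign y) : 0 ≤ x ↔ 0 ≤ y := by
  rw [← sign_nonneg_iff, h, sign_nonneg_iff]

theorem nonpos_iff_of_sign_eq {x y : ℝ} (h : sign x = sign y) : x ≤ 0 ↔ y ≤ 0 := by
  rw [← sign_nonpos_iff, h, sign_nonpos_iff]

theorem eq_zero_iff_of_sign_eq {x y : ℝ} (h : sign x = sign y) : x = 0 ↔ y = 0 := by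
  rw [← sign_eq_zero_iff, h, sign_eq_zero_iff]

theorem sign_add_of_mul_nonneg {x y z x' y' : ℝ} (hz : z ≠ 0) (hx : 0 ≤ z * x) (hy : 0 ≤ z * y)
    (hxy : x ≠ 0 ∨ y ≠ 0) (hx' : sign x = sign x') (hy' : sign y = sign y') :
    sign z = sign (x' + y') := by
  rw [Ne, Ne, eq_zero_iff_of_sign_eq hx', eq_zero_iff_of_sign_eq hy'] at hxy
  rcases lt_or_gt_of_ne hz with h | h
  · replace hx := (nonpos_iff_of_sign_eq hx').1 (nonpos_of_mul_nonneg_right hx h)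
    replace hy := (nonpos_iff_of_sign_eq hy').1 (nonpos_of_mul_nonneg_right hy h)
    rw [sign_neg h, sign_neg]
    rcases hxy with h0 | h0
    · linarith [lt_of_le_of_ne hx h0]
    · linarith [lt_of_le_of_ne hy h0]
  · replace hx := (nonneg_iff_of_sign_eq hx').1 (nonneg_of_mul_nonneg_right hx h)
    replace hy := (nonneg_iff_of_sign_eq hy').1 (nonneg_of_mul_nonneg_right hy h)
    rw [sign_pos h, sign_pos]
    rcases hxy with h0 | h0
    · linarith [lt_of_le_of_ne hx (Ne.symm h0)]
    · linarith [lt_of_le_of_ne hy (Ne.symm h0)]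

theorem sign_combo {a b x y : ℝ} (ha : 0 ≤ a) (hb : 0 < b) (h : x = 0 ∨ sign x = sign y) :
    sign (a * x + b * y) = sign y := by
  rcases h with rfl | h
  · rw [mul_zero, zero_add, sign_mul, sign_pos hb, one_mul]
  · rcases lt_trichotomy y 0 with hy | rfl | hy
    · have hx : x < 0 := by rwa [sign_neg hy, sign_eq_neg_one_iff] at h
      rw [sign_neg hy, sign_neg]
      nlinarith [mul_nonneg ha (neg_nonneg.2 hx.le), mul_pos hb (neg_pos.2 hy)]
    · have hx : x = 0 := by rwa [sign_zero, sign_eq_zero_iff] at h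
      simp [hx]
    · have hx : 0 < x := by rwa [sign_pos hy, sign_eq_one_iff] at h
      rw [sign_pos hy, sign_pos]
      nlinarith [mul_nonneg ha hx.le, mul_pos hb hy]

theorem continuous_side (a b : Plane) : Continuous (side a b) := by
  unfold side; fun_prop

/-- The auxiliary point `c` off the line turns betweenness into sign conditions for three lines. -/
theorem mem_openSegment_iff {a b c p : Plane} (hc : side a b c ≠ 0) :
    p ∈ openSegment ℝ a b ↔ side a b p = 0 ∧ sign (side a c p) = sign (side a c b) ∧
      sign (side b c p) = sign (side b c a) := by
  have ha : side a c b ≠ 0 := by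
    convert neg_ne_zero.2 hc using 1; simp only [side]; ring
  have hb : side b c a ≠ 0 := by rwa [side_rotate]
  have e1 (t : ℝ) : side a c (AffineMap.lineMap a b t) = t * side a c b := by
    rw [side_lineMap, ← side_sub_side, side_self_left]; ring
  have e2 (t : ℝ) : side b c (AffineMap.lineMap a b t) = (1 - t) * side b c a := by
    rw [side_lineMap, ← side_sub_side, side_self_left]; ring
  have key {s d : ℝ} (hd : d ≠ 0) : sign (s * d) = sign d ↔ 0 < s := by
    rw [sign_mul, ← sign_eq_one_iff]
    exact mul_eq_right₀ (by rwa [Ne, sign_eq_zero_iff])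
  rw [openSegment_eq_image_lineMap]
  constructor
  · rintro ⟨t, ⟨h0, h1⟩, rfl⟩
    refine ⟨(side_eq_zero_iff (ne_of_side_ne_zero hc).1).2 ⟨t, rfl⟩, ?_, ?_⟩
    · rwa [e1, key ha]
    · rw [e2, key hb]; linarith
  · rintro ⟨h, h1, h2⟩
    obtain ⟨t, rfl⟩ := (side_eq_zero_iff (ne_of_side_ne_zero hc).1).1 h
    rw [e1, key ha] at h1
    rw [e2, key hb] at h2
    exact ⟨t, ⟨h1, by linarith⟩, rfl⟩

/-- On the way from `p`, which lies on none of the lines, to a point of one of the lines, there is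
a first point on the lines; no line separates it from `p`. -/
theorem exists_first_hit {ι : Type*} [Finite ι] {φ : ι → Plane} {p r : Plane}
    (hp : ∀ i j, i ≠ j → side (φ i) (φ j) p ≠ 0)
    (hr : ∃ i j, i ≠ j ∧ side (φ i) (φ j) r = 0) :
    ∃ t : ℝ, 0 < t ∧ (∃ i j, i ≠ j ∧ side (φ i) (φ j) (AffineMap.lineMap p r t) = 0) ∧
      ∀ i j, 0 ≤ side (φ i) (φ j) p * side (φ i) (φ j) (AffineMap.lineMap p r t) := by
  let K : Set ℝ := Set.Icc 0 1 ∩ ⋃ x : {x : ι × ι // x.1 ≠ x.2},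
    {t | side (φ x.1.1) (φ x.1.2) (AffineMap.lineMap p r t) = 0}
  have hK : IsCompact K := isCompact_Icc.inter_right (isClosed_iUnion_of_finite fun x =>
    isClosed_eq ((continuous_side _ _).comp AffineMap.lineMap_continuous) continuous_const)
  have mem {t : ℝ} : t ∈ K ↔ t ∈ Set.Icc (0 : ℝ) 1 ∧
      ∃ i j, i ≠ j ∧ side (φ i) (φ j) (AffineMap.lineMap p r t) = 0 := by
    simp [K]
  have hne : K.Nonempty := ⟨1, mem.2 ⟨by simp, by simpa using hr⟩⟩
  obtain ⟨t, ht, hmin⟩ := hK.exists_isLeast hne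
  obtain ⟨⟨h0, h1⟩, hit⟩ := mem.1 ht
  have hpos : 0 < t := by
    refine lt_of_le_of_ne h0 ?_
    rintro rfl
    obtain ⟨i, j, hij, h⟩ := hit
    exact hp i j hij (by simpa using h)
  refine ⟨t, hpos, hit, fun i j => ?_⟩
  by_contra! hneg
  have hij : i ≠ j := by rintro rfl; simp at hneg
  set x := side (φ i) (φ j) p with hx
  have e := side_lineMap (φ i) (φ j) p r
  rw [e t, ← hx] at hneg
  set d := turn (φ i) (φ j) p r
  have hx0 : x ≠ 0 := hp i j hij
  have hxd : x * d < 0 := by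
    by_contra! hc
    nlinarith [mul_nonneg h0 hc, mul_self_nonneg x]
  have hd0 : d ≠ 0 := by rintro h; simp [h] at hxd
  -- The affine function `x + s * d` of `s` vanishes at `-x / d`. A sign change before `t` would
  -- give a hit earlier than the minimal one.
  have hs : 0 < -x / d := by
    have : -x / d = -(x * d) / (d * d) := by field_simp
    rw [this]
    exact div_pos (by linarith) (mul_self_pos.2 hd0)
  have hst : -x / d < t := by
    have h2 : (t - -x / d) * -(x * d) = -(x * (x + t * d)) := by field_simp; ring
    have h3 : 0 < (t - -x / d) * -(x * d) := by rw [h2]; linarith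
    linarith [pos_of_mul_pos_left h3 (by linarith)]
  refine absurd (hmin (mem.2 ⟨⟨hs.le, hst.le.trans h1⟩, i, j, hij, ?_⟩)) (not_le.2 hst)
  rw [e]
  field_simp
  ring

/-! ### Cells, and connectedness of the transferred obstacles. -/

/-- The points of the plane of `ψ` whose position relative to the lines through two points of `ψ`
is that of `p` relative to the corresponding lines for `φ`. The factor `e` accounts for a
possible reversal of the orientation. -/
def cell {ι : Type*} (e : ℝ) (φ ψ : ι → Plane) (p : Plane) : Set Plane :=
  {q | ∀ i j, sign (side (φ i) (φ j) p) = sign (e * side (ψ i) (ψ j) q)}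

/-- The union of the cells that correspond to the points of `X`. -/
def transfer {ι : Type*} (e : ℝ) (φ ψ : ι → Plane) (X : Set Plane) : Set Plane :=
  {q | ∃ p ∈ X, q ∈ cell e φ ψ p}

/-- The hypothesis says that `p'` may leave lines through `p` but crosses no other line. Then the
segment enters the cell of `p'` as soon as it leaves `q`. -/
theorem segment_subset_cell_union {ι : Type*} {e : ℝ} {φ ψ : ι → Plane} {p p' q q' : Plane}
    (h : ∀ i j, side (φ i) (φ j) p ≠ 0 →
      sign (side (φ i) (φ j) p') = sign (side (φ i) (φ j) p))
    (hq : q ∈ cell e φ ψ p) (hq' : q' ∈ cell e φ ψ p') :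
    segment ℝ q q' ⊆ cell e φ ψ p ∪ cell e φ ψ p' := by
  rintro _ ⟨a, b, ha, hb, hab, rfl⟩
  rcases hb.eq_or_lt with rfl | hb
  · left
    obtain rfl : a = 1 := by linarith
    simpa using hq
  · right
    intro i j
    have : e * side (ψ i) (ψ j) (a • q + b • q') =
        a * (e * side (ψ i) (ψ j) q) + b * (e * side (ψ i) (ψ j) q') := by
      rw [side_combo _ _ _ _ _ _ hab]; ring
    rw [this, hq' i j, sign_combo ha hb]
    by_cases h0 : side (φ i) (φ j) p = 0
    · exact Or.inl ((eq_zero_iff_of_sign_eq (hq i j)).1 h0)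
    · exact Or.inr (by rw [← hq i j, ← hq' i j, h i j h0])

theorem eventually_sign_side_eq {ι : Type*} [Finite ι] (φ : ι → Plane) (p : Plane) :
    ∀ᶠ p' in nhds p, ∀ i j, side (φ i) (φ j) p ≠ 0 →
      sign (side (φ i) (φ j) p') = sign (side (φ i) (φ j) p) := by
  refine Filter.eventually_all.2 fun i => Filter.eventually_all.2 fun j => ?_
  have hc := (continuous_side (φ i) (φ j)).continuousAt (x := p)
  by_cases h : side (φ i) (φ j) p = 0
  · exact Filter.Eventually.of_forall fun _ h' => absurd h h'
  rcases lt_or_gt_of_ne h with h | h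
  · filter_upwards [hc.eventually_lt_const h] with p' hp' _
    rw [sign_neg hp', sign_neg h]
  · filter_upwards [hc.eventually_const_lt h] with p' hp' _
    rw [sign_pos hp', sign_pos h]

/-- Points of `X` near `p` satisfy the hypothesis of `segment_subset_cell_union`, so their cells are
joined to that of `p`; connectedness of `X` spreads this from local to global. Nonempty cells are
needed to concatenate paths. -/
theorem isConnected_transfer {ι : Type*} [Finite ι] {e : ℝ} {φ ψ : ι → Plane}
    (hne : ∀ p, (cell e φ ψ p).Nonempty) {X : Set Plane} (hX : IsConnected X) :
    IsConnected (transfer e φ ψ X) := by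
  have joined {p p' : Plane} (hp : p ∈ X) (hp' : p' ∈ X) :
      ∀ q ∈ cell e φ ψ p, ∀ q' ∈ cell e φ ψ p', JoinedIn (transfer e φ ψ X) q q' := by
    refine hX.isPreconnected.induction₂ (fun p p' => ∀ q ∈ cell e φ ψ p, ∀ q' ∈ cell e φ ψ p',
      JoinedIn (transfer e φ ψ X) q q') ?_ ?_ ?_ hp hp'
    · intro p hp
      filter_upwards [nhdsWithin_le_nhds (eventually_sign_side_eq φ p), self_mem_nhdsWithin]
        with p' h hp' q hq q' hq'
      refine JoinedIn.of_segment_subset ((segment_subset_cell_union h hq hq').trans ?_)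
      exact Set.union_subset (fun x hx => ⟨p, hp, hx⟩) (fun x hx => ⟨p', hp', hx⟩)
    · intro x y z _ _ _ hxy hyz q hq q' hq'
      obtain ⟨r, hr⟩ := hne y
      exact (hxy q hq r hr).trans (hyz r hr q' hq')
    · intro x y _ _ hxy q hq q' hq'
      exact (hxy q' hq' q hq).symm
  refine (isPathConnected_iff.2 ⟨?_, ?_⟩).isConnected
  · obtain ⟨p, hp⟩ := hX.nonempty
    obtain ⟨q, hq⟩ := hne p
    exact ⟨q, p, hp, hq⟩
  · rintro q ⟨p, hp, hq⟩ q' ⟨p', hp', hq'⟩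
    exact joined hp hp' q hq q' hq'

/-! ### Every cell has a counterpart, and blocked segments correspond. -/

namespace Similar

variable {n : ℕ} {φ ψ : Fin n → Plane} {e : ℝ}

/-- On the line `i j`, choose a point of the second plane with the same position among the
crossings. Lines parallel to `i j` have constant `side` along it, so the value at the vertex `i`
decides. -/
theorem cell_nonempty_of_side_eq_zero (H : Similar φ ψ)
    (he : ∀ i j k, sign (side (φ i) (φ j) (φ k)) = sign (e * side (ψ i) (ψ j) (ψ k)))
    {i j : Fin n} (hij : i ≠ j) {p : Plane} (hp : side (φ i) (φ j) p = 0) :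
    (cell e φ ψ p).Nonempty := by
  have hne : φ i ≠ φ j := fun h => H.fst_ne_left i j hij (congrArg _ h)
  obtain ⟨τ, rfl⟩ := (side_eq_zero_iff hne).1 hp
  obtain ⟨τ', hτ'⟩ := exists_sign_sub_eq
    (κ := {x : Fin n × Fin n // turn (φ x.1) (φ x.2) (φ i) (φ j) ≠ 0})
    (fun x => param (φ i) (φ j) (φ x.1.1) (φ x.1.2))
    (fun x => param (ψ i) (ψ j) (ψ x.1.1) (ψ x.1.2))
    (fun x y => H.sign_param_sub_param x.2 y.2) τ
  refine ⟨AffineMap.lineMap (ψ i) (ψ j) τ', fun k l => ?_⟩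
  by_cases h : turn (φ k) (φ l) (φ i) (φ j) = 0
  · have h' : turn (ψ k) (ψ l) (ψ i) (ψ j) = 0 := by
      by_contra hc; exact H.symm.turn_ne_zero hc h
    rw [side_lineMap, side_lineMap, h, h', mul_zero, mul_zero, add_zero, add_zero, he]
  · rw [side_lineMap_of_turn_ne_zero h, side_lineMap_of_turn_ne_zero (H.turn_ne_zero h),
      mul_left_comm, sign_mul, sign_mul, ← H.sign_turn he, hτ' ⟨(k, l), h⟩]

/-- For `p` off all lines, go from `p` in two opposite directions until the first hit. Both hit
points lie on the boundary of the face of `p` and have counterparts; the midpoint of the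
counterparts lies in the required face. -/
theorem cell_nonempty (H : Similar φ ψ)
    (he : ∀ i j k, sign (side (φ i) (φ j) (φ k)) = sign (e * side (ψ i) (ψ j) (ψ k)))
    (hn : ∃ i j k, side (φ i) (φ j) (φ k) ≠ 0) (p : Plane) : (cell e φ ψ p).Nonempty := by
  by_cases hp : ∀ i j, i ≠ j → side (φ i) (φ j) p ≠ 0
  swap
  · push Not at hp
    obtain ⟨i, j, hij, h⟩ := hp
    exact H.cell_nonempty_of_side_eq_zero he hij h
  obtain ⟨i, j, k, h⟩ := hn
  obtain ⟨hij, hik, -⟩ := index_ne h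
  obtain ⟨d, hd₁, hd₂⟩ : ∃ d : Plane, side (φ i) (φ j) (p + d) = 0 ∧
      side (φ i) (φ k) (p - d) = 0 := by
    set D := side (φ i) (φ j) (φ k) with hD
    -- Moving along `φ j - φ i` does not change `side (φ i) (φ j)`, and likewise with `k`; so each
    -- coefficient solves one of the two equations.
    refine ⟨(-side (φ i) (φ k) p / D) • (φ j - φ i) + (-side (φ i) (φ j) p / D) • (φ k - φ i),
      ?_, ?_⟩
    · have : side (φ i) (φ j) p - side (φ i) (φ j) p / D * D = 0 := by field_simp; ring
      rw [← this]
      simp only [side, Prod.fst_add, Prod.snd_add, Prod.smul_fst, Prod.smul_snd, Prod.fst_sub,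
        Prod.snd_sub, smul_eq_mul] at hD ⊢
      rw [hD]; ring
    · have : side (φ i) (φ k) p - side (φ i) (φ k) p / D * D = 0 := by field_simp; ring
      rw [← this]
      simp only [side, Prod.fst_add, Prod.snd_add, Prod.smul_fst, Prod.smul_snd, Prod.fst_sub,
        Prod.snd_sub, smul_eq_mul] at hD ⊢
      rw [hD]; ring
  obtain ⟨s, hs, ⟨i₁, j₁, hij₁, h₁⟩, hs'⟩ := exists_first_hit hp ⟨i, j, hij, hd₁⟩
  obtain ⟨t, ht, ⟨i₂, j₂, hij₂, h₂⟩, ht'⟩ := exists_first_hit hp ⟨i, k, hik, hd₂⟩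
  obtain ⟨q₁, hq₁⟩ := H.cell_nonempty_of_side_eq_zero he hij₁ h₁
  obtain ⟨q₂, hq₂⟩ := H.cell_nonempty_of_side_eq_zero he hij₂ h₂
  refine ⟨(1 / 2 : ℝ) • q₁ + (1 / 2 : ℝ) • q₂, fun a b => ?_⟩
  by_cases hab : a = b
  · subst hab; simp
  have hpab := hp a b hab
  have key := sign_add_of_mul_nonneg hpab (hs' a b) (ht' a b) ?_ (hq₁ a b) (hq₂ a b)
  · have : e * side (ψ a) (ψ b) ((1 / 2 : ℝ) • q₁ + (1 / 2 : ℝ) • q₂) =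
        (1 / 2) * (e * side (ψ a) (ψ b) q₁ + e * side (ψ a) (ψ b) q₂) := by
      rw [side_combo _ _ _ _ _ _ (by norm_num)]; ring
    rw [this, sign_mul, sign_pos (by norm_num : (0 : ℝ) < 1 / 2), one_mul, key]
  -- If both hit points were on the line `a b`, so would be `p`, which lies between them.
  · by_contra! hc
    obtain ⟨c1, c2⟩ := hc
    rw [side_lineMap] at c1 c2
    have ed : turn (φ a) (φ b) p (p - d) = -turn (φ a) (φ b) p (p + d) := by
      simp [turn]; ring
    rw [ed] at c2
    have : (s + t) * side (φ a) (φ b) p = 0 := by linear_combination t * c1 + s * c2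
    rcases mul_eq_zero.1 this with h0 | h0
    · linarith
    · exact hpab h0

theorem mem_openSegment_iff_of_mem_cell (H : Similar φ ψ) (he0 : e ≠ 0)
    (he : ∀ i j k, sign (side (φ i) (φ j) (φ k)) = sign (e * side (ψ i) (ψ j) (ψ k)))
    {p q : Plane} (hq : q ∈ cell e φ ψ p) {u w : Fin n} (huw : u ≠ w) :
    q ∈ openSegment ℝ (ψ u) (ψ w) ↔ p ∈ openSegment ℝ (φ u) (φ w) := by
  obtain ⟨k, hk⟩ := H.exists_side_left u w huw
  have cancel (x y : ℝ) : sign (e * x) = sign (e * y) ↔ sign x = sign y := by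
    rw [sign_mul, sign_mul]
    exact mul_right_inj' (by rwa [Ne, sign_eq_zero_iff])
  rw [mem_openSegment_iff hk, mem_openSegment_iff (H.side_ne_zero hk),
    eq_zero_iff_of_sign_eq (hq u w), hq u k, hq w k, he, he, cancel, cancel, mul_eq_zero,
    or_iff_right he0]

theorem disjoint_transfer_iff (H : Similar φ ψ) (he0 : e ≠ 0)
    (he : ∀ i j k, sign (side (φ i) (φ j) (φ k)) = sign (e * side (ψ i) (ψ j) (ψ k)))
    (hn : ∃ i j k, side (φ i) (φ j) (φ k) ≠ 0) (X : Set Plane) {u w : Fin n} (huw : u ≠ w) :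
    Disjoint (openSegment ℝ (ψ u) (ψ w)) (transfer e φ ψ X) ↔
      Disjoint (openSegment ℝ (φ u) (φ w)) X := by
  simp only [Set.disjoint_left]
  constructor
  · intro h p hp hpX
    obtain ⟨q, hq⟩ := H.cell_nonempty he hn p
    exact h ((H.mem_openSegment_iff_of_mem_cell he0 he hq huw).2 hp) ⟨p, hpX, hq⟩
  · rintro h q hqs ⟨p, hpX, hq⟩
    exact h ((H.mem_openSegment_iff_of_mem_cell he0 he hq huw).1 hqs) hpX

theorem exists_isObstacleRepresentation (H : Similar φ ψ)
    (hn : ∃ i j k, side (φ i) (φ j) (φ k) ≠ 0) {G : SimpleGraph (Fin n)} {S : Set (Set Plane)}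
    (hS : IsObstacleRepresentation G φ S) :
    ∃ S', IsObstacleRepresentation G ψ S' ∧ S'.encard ≤ S.encard := by
  obtain ⟨e, he0, he⟩ := H.exists_factor
  refine ⟨transfer e φ ψ '' S, ⟨?_, ?_, ?_⟩, Set.encard_image_le _ _⟩
  · intro i j h
    by_contra hij
    exact H.fst_ne_right i j hij (congrArg _ h)
  · rintro _ ⟨X, hX, rfl⟩
    exact isConnected_transfer (H.cell_nonempty he hn) (hS.isConnected X hX)
  · intro u w huw
    rw [hS.adj_iff u w huw, Set.forall_mem_image]
    exact forall₂_congr fun X _ => (H.disjoint_transfer_iff he0 he hn X huw).symm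

end Similar

/-! ### The number of obstacles, and fewer than three vertices. -/

/-- Obstacles far away from all vertices can be added. -/
theorem IsObstacleRepresentation.exists_isHObstacleRepresentation {V : Type*} [Finite V]
    {G : SimpleGraph V} {φ : V → Plane} {S : Set (Set Plane)}
    (hS : IsObstacleRepresentation G φ S) {h : ℕ} (hh : S.encard ≤ h) :
    ∃ S', IsHObstacleRepresentation h G φ S' := by
  obtain ⟨M, hM⟩ := (Set.finite_range fun v => (φ v).1).bddAbove
  -- Single points to the right of all vertices meet no segment between vertices, and there are
  -- infinitely many of them.
  let F : Set (Set Plane) := (fun x : ℝ => {((x, 0) : Plane)}) '' Set.Ioi M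
  have hF : F.Infinite := (Set.Ioi_infinite M).image fun x _ y _ hxy => by
    simpa using hxy
  obtain ⟨S', hSS', hS', hcard⟩ := Set.exists_superset_subset_encard_eq
    (Set.subset_union_left (s := S) (t := F)) hh
    (by rw [(hF.mono Set.subset_union_right).encard_eq]; exact le_top)
  refine ⟨S', ⟨⟨hS.injective, fun X hX => ?_, fun u w huw => ?_⟩, hcard⟩⟩
  · rcases hS' hX with hX | ⟨x, -, rfl⟩
    · exact hS.isConnected X hX
    · exact isConnected_singleton
  · rw [hS.adj_iff u w huw]
    refine ⟨fun hd X hX => ?_, fun hd X hX => hd X (hSS' hX)⟩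
    rcases hS' hX with hX | ⟨x, hx, rfl⟩
    · exact hd X hX
    · rw [Set.disjoint_singleton_right]
      rintro ⟨a, b, ha, hb, hab, hp⟩
      have hx1 : a * (φ u).1 + b * (φ w).1 = x := by simpa using congrArg Prod.fst hp
      have hu : (φ u).1 ≤ M := hM ⟨u, rfl⟩
      have hw : (φ w).1 ≤ M := hM ⟨w, rfl⟩
      have hxM : M < x := hx
      obtain rfl : b = 1 - a := by linarith
      nlinarith [mul_le_mul_of_nonneg_left hu ha.le, mul_le_mul_of_nonneg_left hw hb.le]

/-- There is at most one pair of vertices. If it is not adjacent, `S` is nonempty, and the open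
segment itself can serve as the only obstacle. -/
theorem exists_isObstacleRepresentation_of_lt_three {n : ℕ} (hn : n < 3)
    {G : SimpleGraph (Fin n)} {φ ψ : Fin n → Plane} (hψ : Function.Injective ψ)
    {S : Set (Set Plane)} (hS : IsObstacleRepresentation G φ S) :
    ∃ S', IsObstacleRepresentation G ψ S' ∧ S'.encard ≤ S.encard := by
  by_cases hG : ∀ u w, u ≠ w → G.Adj u w
  · exact ⟨∅, ⟨hψ, by simp, fun u w huw => by simp [hG u w huw]⟩, by simp⟩
  push Not at hG
  obtain ⟨u, w, huw, hadj⟩ := hG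
  have hne : S.Nonempty := by
    by_contra hc
    rw [Set.not_nonempty_iff_eq_empty] at hc
    exact hadj ((hS.adj_iff u w huw).2 (by simp [hc]))
  have hseg : (openSegment ℝ (ψ u) (ψ w)).Nonempty := ⟨_, midpoint_mem_openSegment _ _⟩
  refine ⟨{openSegment ℝ (ψ u) (ψ w)}, ⟨hψ, ?_, fun u' w' huw' => ?_⟩, ?_⟩
  · rintro _ rfl
    exact ⟨hseg, (convex_openSegment _ _).isPreconnected⟩
  · have hcase : (u' = u ∧ w' = w) ∨ (u' = w ∧ w' = u) := by omega
    have hnd : ¬ Disjoint (openSegment ℝ (ψ u) (ψ w)) (openSegment ℝ (ψ u) (ψ w)) := by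
      rw [disjoint_self]; exact hseg.ne_empty
    rcases hcase with ⟨rfl, rfl⟩ | ⟨rfl, rfl⟩
    · simpa [hadj] using hnd
    · rw [G.adj_comm, openSegment_symm ℝ (ψ u')]
      simpa [hadj] using hnd
  · rw [Set.encard_singleton]
    exact Set.one_le_encard_iff_nonempty.2 hne

end ObstacleNumber

theorem mainTheorem4 (n h : ℕ) (G : SimpleGraph (Fin n))
    (φ₁ φ₂ : Fin n → ObstacleNumber.Plane)
    (hφ₁ : Function.Injective φ₁) (hφ₂ : Function.Injective φ₂)
    (hx : ∀ i j : Fin n, i ≠ j → (φ₁ i).1 ≠ (φ₁ j).1)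
    (hcol : 3 ≤ n → ¬ Collinear ℝ (Set.range φ₁))
    (hσ : ObstacleNumber.superOrderType φ₁ = ObstacleNumber.superOrderType φ₂)
    (hrep : ∃ S₁ : Set (Set ObstacleNumber.Plane),
      ObstacleNumber.IsHObstacleRepresentation h G φ₁ S₁) :
    ∃ S₂ : Set (Set ObstacleNumber.Plane),
      ObstacleNumber.IsHObstacleRepresentation h G φ₂ S₂ := by
  obtain ⟨S₁, hS₁⟩ := hrep
  obtain ⟨S, hS, hcard⟩ : ∃ S, ObstacleNumber.IsObstacleRepresentation G φ₂ S ∧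
      S.encard ≤ S₁.encard := by
    rcases lt_or_ge n 3 with hn | hn
    · exact ObstacleNumber.exists_isObstacleRepresentation_of_lt_three hn hφ₂
        hS₁.toIsObstacleRepresentation
    · have H := ObstacleNumber.Similar.of_not_collinear hx (hcol hn) hσ
      have h01 : (⟨0, by omega⟩ : Fin n) ≠ ⟨1, by omega⟩ := by simp
      obtain ⟨k, hk⟩ := H.exists_side_left _ _ h01
      exact H.exists_isObstacleRepresentation ⟨_, _, k, hk⟩ hS₁.toIsObstacleRepresentation
  exact hS.exists_isHObstacleRepresentation (hcard.trans hS₁.encard_eq.le)
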